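/- Let $n$ be an odd prime, and let $$\sigma^{(1)}=\begin{pmatrix}0&1\\1&0\end{pmatrix},\qquad \sigma^{(2)}=\begin{pmatrix}0&-i\\i&0\end{pmatrix},\qquad \sigma^{(3)}=\begin{pmatrix}1&0\\0&-1\end{pmatrix}$$ be the Pauli matrices. For $a\in\{1,2,3\}$ and $1\le j\le n$ let $\sigma_j^{(a)}=I_2^{\otimes(j-1)}\otimes\sigma^{(a)}\otimes I_2^{\otimes(n-j)}$, a $2^n\times 2^n$ matrix acting on $(\mathbb{C}^2)^{\otimes n}$, with cyclic labelling $\sigma_{n+1}^{(a)}=\sigma_1^{(a)}$. Then there exists $\epsilon\in\mathbb{R}$ such that the matrix $$H_n^{(\epsilon XY+Z)}=\sum_{j=1}^n\left(\epsilon\,\sigma_j^{(1)}\sigma_{j+1}^{(2)}+\sigma_j^{(3)}\right)$$ has a non-degenerate spectrum, that is, its $2^n$ eigenvalues, counted with multiplicity, are pairwise distinct. -/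

import Mathlib

noncomputable section

/-- The matrices `σ⁽⁰⁾ = I₂`, `σ⁽¹⁾`, `σ⁽²⁾`, `σ⁽³⁾` (the identity and the three Pauli matrices). -/
def pauli : Fin 4 → Matrix (Fin 2) (Fin 2) ℂ :=
  ![!![1, 0; 0, 1], !![0, 1; 1, 0], !![0, -Complex.I; Complex.I, 0], !![1, 0; 0, -1]]

/-- The `n`-fold Kronecker product `A₀ ⊗ A₁ ⊗ ⋯ ⊗ Aₙ₋₁` of `2 × 2` matrices, as a matrix on
`(ℂ²)^{⊗ n}`, whose standard (product) basis is indexed by the multi-indices `Fin n → Fin 2`. -/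
def tensorMatrix {n : ℕ} (A : Fin n → Matrix (Fin 2) (Fin 2) ℂ) :
    Matrix (Fin n → Fin 2) (Fin n → Fin 2) ℂ :=
  Matrix.of fun x y => ∏ k, A k (x k) (y k)

/-- `σ_j⁽ᵃ⁾ = I₂ ⊗ ⋯ ⊗ I₂ ⊗ σ⁽ᵃ⁾ ⊗ I₂ ⊗ ⋯ ⊗ I₂`, with the factor `σ⁽ᵃ⁾` at site `j`. -/
def siteSigma {n : ℕ} (a : Fin 4) (j : Fin n) : Matrix (Fin n → Fin 2) (Fin n → Fin 2) ℂ :=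
  tensorMatrix (Function.update (fun _ => 1) j (pauli a))

/-- `H = ∑_j (ε σ_j⁽¹⁾ σ_{j+1}⁽²⁾ + σ_j⁽³⁾)` on the ring of `n` qubits. The sites are labelled by
`Fin n`, in which `j + 1` is taken modulo `n`, so that the labelling is cyclic. -/
def hamXYplusZ (n : ℕ) [NeZero n] (ε : ℝ) : Matrix (Fin n → Fin 2) (Fin n → Fin 2) ℂ :=
  ∑ j : Fin n, ((ε : ℂ) • (siteSigma 1 j * siteSigma 2 (j + 1)) + siteSigma 3 j)

/-- A square complex matrix has a non-degenerate spectrum if no eigenvalue is repeated: the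
eigenvalues, listed with multiplicity as the roots of the characteristic polynomial, are pairwise
distinct. -/
def HasNondegenerateSpectrum {m : Type*} [Fintype m] [DecidableEq m] (A : Matrix m m ℂ) : Prop :=
  A.charpoly.roots.Nodup

end

/-! The chain is a free-fermion system in disguise. Under the Jordan-Wigner transformation, with
Majorana operators `a_j`, `b_j`, the Hamiltonian becomes minus the quadratic form `i ∑ (a_j b_j + ε
b_j b_{j+1})`, except that the bond closing the ring acquires a factor depending on the parity `∏
σ_j⁽³⁾`. The cyclic quadratic form is diagonalized by plane waves; its eigenvalues include all `2^n`
signed sums `∑ ± μ_k` with `μ_k = modeEnergy ε k` (`exists_eigenvector_of_majorana`).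

In the odd parity sector the quadratic form equals `-H`. In the even sector it equals `-H` with the
last bond reversed in sign, and for odd `n` alternating quarter turns followed by a reflection of
the ring remove this sign (`hamXYplusZ_mul_quarterTurns_mul_reflection`). Hence every signed sum is
an eigenvalue of `H`. Multiplicities need not be tracked: if the `2^n` sums are distinct, they
exhaust the spectrum.

Distinctness for some `ε` is arithmetic (`exists_sum_modeEnergy_injective`). An integer relation
between the analytic functions `μ_k` near `ε = 0` splits into even and odd parts in `ε`.
Independence of the square roots makes its coefficients antisymmetric in `k`, and the odd part then
becomes a relation between nontrivial `n`-th roots of unity, which is trivial for prime `n`. -/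

/-- The sine `sin (2πk/n)`, as the imaginary part of the standard additive character. -/
noncomputable def sineAt {n : ℕ} [NeZero n] (k : ZMod n) : ℝ := (ZMod.stdAddChar k : ℂ).im

/-- The single-particle energy `ε sin (2πk/n) + √(1 + ε² sin² (2πk/n))`. -/
noncomputable def modeEnergy {n : ℕ} [NeZero n] (ε : ℝ) (k : ZMod n) : ℝ :=
  ε * sineAt k + √(1 + ε ^ 2 * sineAt k ^ 2)

/-! ### Arithmetic of the mode energies: their signed sums are distinct for some `ε`. -/

section Arithmetic
variable {n : ℕ} [NeZero n]

theorem stdAddChar_neg_eq_star (k : ZMod n) :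
    (ZMod.stdAddChar (-k) : ℂ) = star (ZMod.stdAddChar k : ℂ) := by
  rw [AddChar.map_neg_eq_conj]; rfl

theorem sineAt_neg (k : ZMod n) : sineAt (-k) = -sineAt k := by
  simp [sineAt, stdAddChar_neg_eq_star]

theorem modeEnergy_mul_neg (ε : ℝ) (k : ZMod n) : modeEnergy ε k * modeEnergy ε (-k) = 1 := by
  have h : √(1 + ε ^ 2 * sineAt k ^ 2) ^ 2 = 1 + ε ^ 2 * sineAt k ^ 2 :=
    Real.sq_sqrt (by positivity)
  simp only [modeEnergy, sineAt_neg, neg_sq]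
  linear_combination h

theorem modeEnergy_sub_neg (ε : ℝ) (k : ZMod n) :
    modeEnergy ε k - modeEnergy ε (-k) = 2 * ε * sineAt k := by
  simp only [modeEnergy, sineAt_neg, neg_sq]
  ring

theorem two_mul_sineAt (k : ZMod n) :
    2 * (sineAt k : ℂ) = -Complex.I * (ZMod.stdAddChar k - ZMod.stdAddChar (-k)) := by
  rw [stdAddChar_neg_eq_star, sineAt]
  apply Complex.ext <;> (simp; try ring)

theorem sum_stdAddChar_mul (b : ZMod n) :
    ∑ x : ZMod n, (ZMod.stdAddChar (x * b) : ℂ) = if b = 0 then (n : ℂ) else 0 := by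
  rw [AddChar.sum_mulShift b (ZMod.isPrimitive_stdAddChar n), ZMod.card]
  split_ifs <;> simp

/-- With `w = χ(2j)` and `u = χ(2k)`, equal squared sines mean `w + w⁻¹ = u + u⁻¹`, that is `(w -
u)(w - u⁻¹) = 0`. Doubling is injective modulo an odd `n`. -/
theorem eq_or_eq_neg_of_sineAt_sq_eq (hodd : Odd n) {j k : ZMod n}
    (h : sineAt j ^ 2 = sineAt k ^ 2) : j = k ∨ j = -k := by
  have h2 : IsUnit (2 : ZMod n) := by
    have : IsUnit ((2 : ℕ) : ZMod n) :=
      (ZMod.isUnit_iff_coprime 2 n).2 ((Nat.coprime_two_left).2 hodd)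
    exact_mod_cast this
  have hp (k : ZMod n) : (2 * (sineAt k : ℂ)) ^ 2 =
      2 - ZMod.stdAddChar (2 * k) - ZMod.stdAddChar (-(2 * k)) := by
    have h1 : (ZMod.stdAddChar k * ZMod.stdAddChar (-k) : ℂ) = 1 := by
      rw [← AddChar.map_add_eq_mul]; simp
    rw [two_mul_sineAt, two_mul, neg_add, AddChar.map_add_eq_mul, AddChar.map_add_eq_mul]
    linear_combination (ZMod.stdAddChar k - ZMod.stdAddChar (-k) : ℂ) ^ 2 * Complex.I_sq + 2 * h1
  have hne (a : ZMod n) : (ZMod.stdAddChar a * ZMod.stdAddChar (-a) : ℂ) = 1 := by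
    rw [← AddChar.map_add_eq_mul]; simp
  have hc : (2 * (sineAt j : ℂ)) ^ 2 = (2 * (sineAt k : ℂ)) ^ 2 := by
    rw [mul_pow, mul_pow, ← Complex.ofReal_pow, ← Complex.ofReal_pow, h]
  rw [hp, hp] at hc
  have hz : (ZMod.stdAddChar (2 * j) - ZMod.stdAddChar (2 * k) : ℂ) *
      (ZMod.stdAddChar (2 * j) - ZMod.stdAddChar (-(2 * k))) = 0 := by
    linear_combination (-ZMod.stdAddChar (2 * j) : ℂ) * hc + hne (2 * k) - hne (2 * j)
  rcases mul_eq_zero.1 hz with h | h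
  · exact .inl (h2.mul_left_cancel (ZMod.injective_stdAddChar (sub_eq_zero.1 h)))
  · refine .inr (h2.mul_left_cancel ?_)
    rw [mul_neg]
    exact ZMod.injective_stdAddChar (sub_eq_zero.1 h)

/-- A weighted sum over finitely many points all of whose moments vanish has zero total weight on
every fibre. -/
theorem sum_fiber_eq_zero_of_moments {ι : Type*} [Fintype ι] (c a : ι → ℝ)
    (h : ∀ p : ℕ, ∑ i, c i * a i ^ p = 0) (x : ℝ) :
    ∑ i with a i = x, c i = 0 := by
  classical
  have hP (P : Polynomial ℝ) : ∑ i, c i * P.eval (a i) = 0 := by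
    simp_rw [Polynomial.eval_eq_sum_range, Finset.mul_sum]
    rw [Finset.sum_comm]
    refine Finset.sum_eq_zero fun p _ => ?_
    have := congrArg (P.coeff p * ·) (h p)
    simp only [Finset.mul_sum, mul_zero] at this
    rw [← this]
    exact Finset.sum_congr rfl fun i _ => by ring
  -- The unnormalized Lagrange polynomial, vanishing at every value of `a` other than `x`, isolates
  -- the fibre.
  have hx := hP (∏ y ∈ (Finset.univ.image a).erase x, (Polynomial.X - Polynomial.C y))
  simp only [Polynomial.eval_prod, Polynomial.eval_sub, Polynomial.eval_X,
    Polynomial.eval_C] at hx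
  rw [← Finset.sum_filter_add_sum_filter_not Finset.univ (fun i => a i = x)] at hx
  rw [Finset.sum_eq_zero (s := Finset.univ.filter fun i => ¬ a i = x), add_zero,
    Finset.sum_congr rfl (g := fun i => c i * ∏ y ∈ (Finset.univ.image a).erase x, (x - y)),
    ← Finset.sum_mul] at hx
  · refine (mul_eq_zero.1 hx).resolve_right (Finset.prod_ne_zero_iff.2 fun y hy => ?_)
    exact sub_ne_zero.2 (Finset.ne_of_mem_erase hy).symm
  · intro i hi; rw [(Finset.mem_filter.1 hi).2]
  · intro i hi
    rw [Finset.prod_eq_zero (i := a i), mul_zero]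
    · exact Finset.mem_erase.2 ⟨(Finset.mem_filter.1 hi).2, by simp⟩
    · simp

/-- Repeated differentiation in `t`; the exponents `1/2 - p` are never zero, so the numerical factor
cancels each time. -/
theorem sum_mul_rpow_eq_zero {ι : Type*} [Fintype ι] (c a : ι → ℝ) (ha : ∀ i, 0 ≤ a i) {δ : ℝ}
    (h : ∀ t ∈ Set.Ioo 0 δ, ∑ i, c i * √(1 + a i * t) = 0) (p : ℕ) :
    ∀ t ∈ Set.Ioo 0 δ, ∑ i, c i * a i ^ p * (1 + a i * t) ^ ((1 : ℝ) / 2 - p) = 0 := by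
  induction p with
  | zero => simpa [Real.sqrt_eq_rpow] using h
  | succ p ih =>
    intro t ht
    have hd : HasDerivAt (fun t => ∑ i, c i * a i ^ p * (1 + a i * t) ^ ((1 : ℝ) / 2 - p))
        (∑ i, c i * a i ^ p * (a i * ((1 : ℝ) / 2 - p) *
          (1 + a i * t) ^ ((1 : ℝ) / 2 - p - 1))) t := by
      refine HasDerivAt.fun_sum fun i _ => HasDerivAt.const_mul _ ?_
      refine HasDerivAt.rpow_const ?_ (.inl ?_)
      · simpa using ((hasDerivAt_id t).const_mul (a i)).const_add 1
      · have := mul_nonneg (ha i) ht.1.le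
        positivity
    have h0 : HasDerivAt (fun t => ∑ i, c i * a i ^ p * (1 + a i * t) ^ ((1 : ℝ) / 2 - p)) 0 t :=
      (hasDerivAt_const t (0 : ℝ)).congr_of_eventuallyEq
        (Filter.eventuallyEq_of_mem (isOpen_Ioo.mem_nhds ht) ih)
    have hz := hd.unique h0
    have hp : ((1 : ℝ) / 2 - p) ≠ 0 := by
      intro h
      have : (2 * p : ℝ) = 1 := by linarith
      have : 2 * p = 1 := by exact_mod_cast this
      omega
    have : ((1 : ℝ) / 2 - p) *
        ∑ i, c i * a i ^ (p + 1) * (1 + a i * t) ^ ((1 : ℝ) / 2 - (p + 1 : ℕ)) = 0 := by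
      rw [← hz, Finset.mul_sum]
      refine Finset.sum_congr rfl fun i _ => ?_
      rw [show (1 : ℝ) / 2 - (p + 1 : ℕ) = 1 / 2 - p - 1 by push_cast; ring]
      ring
    exact (mul_eq_zero.1 this).resolve_left hp

/-- Linear independence of the functions `t ↦ √(1 + a t)` for distinct `a ≥ 0`. -/
theorem sum_fiber_eq_zero_of_sum_sqrt {ι : Type*} [Fintype ι] (c a : ι → ℝ) (ha : ∀ i, 0 ≤ a i)
    {δ : ℝ} (hδ : 0 < δ) (h : ∀ t ∈ Set.Ioo 0 δ, ∑ i, c i * √(1 + a i * t) = 0) (x : ι) :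
    ∑ i with a i = a x, c i = 0 := by
  have ht : δ / 2 ∈ Set.Ioo 0 δ := ⟨by linarith, by linarith⟩
  set t := δ / 2
  have hpos (i) : 0 < 1 + a i * t := by have := mul_nonneg (ha i) ht.1.le; positivity
  -- At a fixed `t` the differentiated identities are the moments of the points `a/(1 + a t)`, with
  -- weights `c √(1 + a t)`. The map `a ↦ a/(1 + a t)` is injective, so fibres are those of `a`.
  have key := sum_fiber_eq_zero_of_moments (fun i => c i * (1 + a i * t) ^ ((1 : ℝ) / 2))
    (fun i => a i / (1 + a i * t)) (fun p => by
      rw [← sum_mul_rpow_eq_zero c a ha h p t ht]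
      refine Finset.sum_congr rfl fun i _ => ?_
      rw [Real.rpow_sub (hpos i), Real.rpow_natCast, div_pow]
      ring) (a x / (1 + a x * t))
  have hiff (i) : a i / (1 + a i * t) = a x / (1 + a x * t) ↔ a i = a x := by
    rw [div_eq_div_iff (hpos i).ne' (hpos x).ne']
    constructor
    · intro h; linarith
    · intro h; rw [h]
  simp only [hiff] at key
  rw [Finset.sum_congr rfl (g := fun i => c i * (1 + a x * t) ^ ((1 : ℝ) / 2))
    (fun i hi => by rw [(Finset.mem_filter.1 hi).2]), ← Finset.sum_mul] at key
  exact (mul_eq_zero.1 key).resolve_right (Real.rpow_pos_of_pos (hpos x) _).ne'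

/-- For prime `n`, an integer relation between the `n`-th roots of unity without constant term is
trivial. -/
theorem eq_zero_of_sum_stdAddChar_eq_zero (hn : n.Prime) (y : ZMod n → ℤ) (h0 : y 0 = 0)
    (h : ∑ k, (y k : ℂ) * ZMod.stdAddChar k = 0) : y = 0 := by
  obtain ⟨m, rfl⟩ : ∃ m, n = m + 1 := ⟨n - 1, by have := hn.pos; omega⟩
  set ζ : ℂ := Complex.exp (2 * Real.pi * Complex.I / (m + 1 : ℕ)) with hζ
  have hprim : IsPrimitiveRoot ζ (m + 1) := Complex.isPrimitiveRoot_exp _ (by omega)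
  have hpow (i : ℕ) : (ZMod.stdAddChar ((i : ZMod (m + 1))) : ℂ) = ζ ^ i := by
    have := ZMod.stdAddChar_coe (N := m + 1) i
    rw [← Complex.exp_nat_mul]
    push_cast at this ⊢
    rw [this]
    congr 1
    ring
  have hdeg : (minpoly ℚ ζ).natDegree = m := by
    rw [← Polynomial.cyclotomic_eq_minpoly_rat hprim (by omega), Polynomial.natDegree_cyclotomic,
      Nat.totient_prime hn]
    rfl
  have hli := linearIndependent_pow (K := ℚ) ζ
  rw [Fintype.linearIndependent_iff] at hli
  -- Without a constant term the relation can be divided by `ζ`, leaving exponents below `m = n -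
  -- 1`, the degree of `ζ` over `ℚ`.
  have hsum : ∑ i : Fin m, (y ((i.val + 1 : ℕ) : ZMod (m + 1)) : ℂ) * ζ ^ (i : ℕ) = 0 := by
    have hζ0 : ζ ≠ 0 := Complex.exp_ne_zero _
    have e : ∑ k, (y k : ℂ) * ZMod.stdAddChar k =
        ∑ i : Fin (m + 1), (y ((i : ℕ) : ZMod (m + 1)) : ℂ) * ζ ^ (i : ℕ) := by
      refine Finset.sum_congr rfl fun (i : Fin (m + 1)) _ => ?_
      have : ((i : ℕ) : ZMod (m + 1)) = i := Fin.cast_val_eq_self i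
      rw [← hpow, this]
    rw [e, Fin.sum_univ_succ] at h
    simp only [Fin.val_zero, Nat.cast_zero, h0, Int.cast_zero, zero_mul, zero_add,
      Fin.val_succ, pow_succ] at h
    rw [← mul_left_inj' hζ0, zero_mul, ← h, Finset.sum_mul]
    exact Finset.sum_congr rfl fun i _ => by push_cast; ring
  have hz := hli (fun i => (y ((i.val + 1 : ℕ) : ZMod (m + 1)) : ℚ)) (by
    rw [← hsum]
    refine Fintype.sum_equiv (finCongr hdeg) _ _ fun i => ?_
    simp [Algebra.smul_def])
  funext (k : Fin (m + 1))
  refine Fin.cases ?_ (fun i => ?_) k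
  · exact h0
  · have := hz ((finCongr hdeg).symm i)
    have e : ((i.val + 1 : ℕ) : ZMod (m + 1)) = i.succ := by
      rw [← Fin.val_succ]; exact Fin.cast_val_eq_self i.succ
    simp only [finCongr_symm, finCongr_apply, Fin.val_cast, e] at this
    exact_mod_cast this

/-- The part even in `ε`, read as a function of `t = ε²`, gives `y 0 = 0` and `y (-k) = -y k`. The
odd part says that `∑ y_k χ(k)` has zero imaginary part, and antisymmetry kills the real part. -/
theorem eq_zero_of_eventually_sum_modeEnergy_eq_zero (hn : n.Prime) (hodd : Odd n)
    (y : ZMod n → ℤ) (h : ∀ᶠ ε in nhds 0, ∑ k, (y k : ℝ) * modeEnergy ε k = 0) : y = 0 := by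
  obtain ⟨r, hr, hball⟩ := Metric.eventually_nhds_iff.1 h
  have hb (ε : ℝ) (hε : |ε| < r) : ∑ k, (y k : ℝ) * modeEnergy ε k = 0 :=
    hball (by simpa [Real.dist_eq] using hε)
  have heven (ε : ℝ) (hε : |ε| < r) : ∑ k, (y k : ℝ) * √(1 + ε ^ 2 * sineAt k ^ 2) = 0 := by
    have h1 := hb ε hε
    have h2 := hb (-ε) (by rwa [abs_neg])
    simp only [modeEnergy, neg_sq, mul_add, Finset.sum_add_distrib, neg_mul, mul_neg,
      Finset.sum_neg_distrib] at h1 h2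
    linarith
  have hlin : ∑ k, (y k : ℝ) * sineAt k = 0 := by
    have hε : |r / 2| < r := by rw [abs_of_pos] <;> linarith
    have h1 := hb _ hε
    simp only [modeEnergy, mul_add, Finset.sum_add_distrib, heven _ hε, add_zero] at h1
    have : r / 2 * ∑ k, (y k : ℝ) * sineAt k = 0 := by
      rw [← h1, Finset.mul_sum]
      exact Finset.sum_congr rfl fun k _ => by ring
    exact (mul_eq_zero.1 this).resolve_left (by positivity)
  have hfib (x : ZMod n) := sum_fiber_eq_zero_of_sum_sqrt (fun k => (y k : ℝ))
    (fun k => sineAt k ^ 2) (fun k => sq_nonneg _) (δ := r ^ 2) (by positivity) (fun t ht => by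
      rw [← heven (√t) (by
        rw [abs_of_nonneg (Real.sqrt_nonneg t)]
        exact (Real.sqrt_lt' hr).2 ht.2)]
      simp only [Real.sq_sqrt ht.1.le, mul_comm]) x
  have hset (x : ZMod n) :
      (Finset.univ.filter fun k => sineAt k ^ 2 = sineAt x ^ 2) = {x, -x} := by
    ext k
    simp only [Finset.mem_filter, Finset.mem_univ, true_and, Finset.mem_insert,
      Finset.mem_singleton]
    refine ⟨eq_or_eq_neg_of_sineAt_sq_eq hodd, ?_⟩
    rintro (rfl | rfl)
    · rfl
    · rw [sineAt_neg, neg_sq]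
  simp only [hset] at hfib
  have h0 : y 0 = 0 := by simpa using hfib 0
  have hanti (k : ZMod n) : y (-k) = -y k := by
    by_cases hk : k = -k
    · have := hfib k
      rw [← hk] at this ⊢
      have : y k = 0 := by simpa using this
      omega
    · have := hfib k
      rw [Finset.sum_pair hk] at this
      have : y k + y (-k) = 0 := by exact_mod_cast this
      omega
  refine eq_zero_of_sum_stdAddChar_eq_zero hn y h0 ?_
  apply Complex.ext
  · have hre (k : ZMod n) : (ZMod.stdAddChar (-k) : ℂ).re = (ZMod.stdAddChar k : ℂ).re := by
      rw [stdAddChar_neg_eq_star]; simp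
    have : ∑ k, (y k : ℝ) * (ZMod.stdAddChar k : ℂ).re =
        -∑ k, (y k : ℝ) * (ZMod.stdAddChar k : ℂ).re := by
      conv_lhs => rw [← Equiv.sum_comp (Equiv.neg (ZMod n))]
      simp [hanti, hre]
    simp
    linarith
  · simpa [sineAt] using hlin

/-- Each of the finitely many differences is analytic at `0` and not locally zero, hence nonzero on
a punctured neighbourhood of `0`; a common `ε` exists there. At `ε = 0` itself all energies are `1`.
-/
theorem exists_sum_modeEnergy_injective (hn : n.Prime) (hodd : Odd n) :
    ∃ ε : ℝ, Function.Injective fun x : ZMod n → ℤˣ =>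
      ∑ k, ((x k : ℤ) : ℝ) * modeEnergy ε k := by
  have han (y : ZMod n → ℤ) : AnalyticAt ℝ (fun ε => ∑ k, (y k : ℝ) * modeEnergy ε k) 0 := by
    unfold modeEnergy
    refine Finset.analyticAt_fun_sum _ fun k _ => analyticAt_const.mul (AnalyticAt.add ?_ ?_)
    · fun_prop
    · exact (ContDiffAt.sqrt (f := fun ε : ℝ => 1 + ε ^ 2 * sineAt k ^ 2)
        (by fun_prop) (by simp)).analyticAt
  have hev : ∀ᶠ ε in nhdsWithin (0 : ℝ) {0}ᶜ, ∀ p : (ZMod n → ℤˣ) × (ZMod n → ℤˣ),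
      p.1 ≠ p.2 → ∑ k, (((p.1 k : ℤ) - (p.2 k : ℤ) : ℤ) : ℝ) * modeEnergy ε k ≠ 0 := by
    rw [Filter.eventually_all]
    intro p
    by_cases hp : p.1 = p.2
    · simp [hp]
    rcases (han fun k => (p.1 k : ℤ) - (p.2 k : ℤ)).eventually_eq_zero_or_eventually_ne_zero with
      h | h
    · have := eq_zero_of_eventually_sum_modeEnergy_eq_zero hn hodd _ h
      exact absurd (funext fun k => Units.ext (sub_eq_zero.1 (congrFun this k))) hp
    · filter_upwards [h] with ε hε _ using hε
  obtain ⟨ε, hε⟩ := hev.exists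
  refine ⟨ε, fun x x' hxx => by_contra fun hne => hε (x, x') hne ?_⟩
  simp only at hxx
  simp only [Int.cast_sub, sub_mul, Finset.sum_sub_distrib, hxx, sub_self]

end Arithmetic

/-! ### Clifford relations and joint eigenvectors of fermionic modes. -/

section Clifford
variable {ι A : Type*} [Fintype ι] [DecidableEq ι] [Ring A] [Algebra ℂ A]

theorem smul_sum_anticomm {γ : ι → A}
    (hγ : ∀ i j, γ i * γ j + γ j * γ i = if i = j then 2 else 0) (f g : ι → ℂ) :
    (∑ i, f i • γ i) * (∑ i, g i • γ i) + (∑ i, g i • γ i) * (∑ i, f i • γ i) =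
      algebraMap ℂ A (2 * ∑ i, f i * g i) := by
  have h1 : (∑ i, f i • γ i) * (∑ i, g i • γ i) = ∑ i, ∑ j, (f i * g j) • (γ i * γ j) := by
    simp_rw [Finset.sum_mul_sum, smul_mul_smul_comm]
  have h2 : (∑ i, g i • γ i) * (∑ i, f i • γ i) = ∑ i, ∑ j, (f i * g j) • (γ j * γ i) := by
    rw [Finset.sum_mul_sum, Finset.sum_comm]
    simp_rw [smul_mul_smul_comm, mul_comm]
  rw [h1, h2, ← Finset.sum_add_distrib]
  simp_rw [← Finset.sum_add_distrib, ← smul_add, hγ]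
  simp [Algebra.algebraMap_eq_smul_one, Finset.mul_sum, mul_smul,
    ← one_add_one_eq_two, add_smul]

/-- A quadratic expression in Clifford generators depends only on the antisymmetric part and the
trace of its coefficients. -/
theorem sum_smul_mul_eq_of_antisymm {γ : ι → A}
    (hγ : ∀ i j, γ i * γ j + γ j * γ i = if i = j then 2 else 0) (M M' : ι → ι → ℂ)
    (hM : ∀ i j, M i j - M j i = M' i j - M' j i) :
    ∑ i, ∑ j, M i j • (γ i * γ j) =
      ∑ i, ∑ j, M' i j • (γ i * γ j) + algebraMap ℂ A (∑ i, M i i - ∑ i, M' i i) := by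
  -- Split `2M = (M - Mᵀ) + (M + Mᵀ)`: the Clifford relations reduce the symmetric part to a scalar.
  have key (M : ι → ι → ℂ) : (2 : ℂ) • ∑ i, ∑ j, M i j • (γ i * γ j) =
      ∑ i, ∑ j, (M i j - M j i) • (γ i * γ j) + (2 : ℂ) • algebraMap ℂ A (∑ i, M i i) := by
    have hs : ∑ i, ∑ j, M j i • (γ i * γ j + γ j * γ i) =
        (2 : ℂ) • algebraMap ℂ A (∑ i, M i i) := by
      simp_rw [hγ]
      simp [Algebra.algebraMap_eq_smul_one, ← one_add_one_eq_two, add_smul,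
        Finset.sum_add_distrib]
    rw [← hs, two_smul]
    nth_rewrite 2 [Finset.sum_comm]
    simp_rw [← Finset.sum_add_distrib]
    refine Finset.sum_congr rfl fun i _ => Finset.sum_congr rfl fun j _ => ?_
    module
  have h2 : (2 : ℂ) ≠ 0 := two_ne_zero
  refine smul_right_injective A h2 ?_
  simp only [smul_add]
  rw [key, key, map_sub]
  simp_rw [hM]
  module

end Clifford

theorem sq_eq_zero_of_anticomm {A : Type*} [Ring A] [Algebra ℂ A] {p : A}
    (h : p * p + p * p = 0) : p * p = 0 := by
  rw [← two_smul ℂ (p * p)] at h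
  exact (smul_eq_zero.1 h).resolve_left two_ne_zero

/-- Fermionic modes acting on a nonzero space have a joint eigenvector of the number operators for
every occupation pattern. -/
theorem exists_joint_eigenvector {κ V : Type*} [Fintype κ] [AddCommGroup V] [Module ℂ V]
    [Nontrivial V] (N X : κ → Module.End ℂ V)
    (hN : ∀ k, N k * N k = 1) (hNN : ∀ k l, N k * N l = N l * N k)
    (hX : ∀ k, X k * X k = 1) (hXN : ∀ k, X k * N k = -(N k * X k))
    (hXN' : ∀ k l, k ≠ l → X k * N l = N l * X k) (x : κ → ℤˣ) :
    ∃ v : V, v ≠ 0 ∧ ∀ k, N k v = ((x k : ℤ) : ℂ) • v := by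
  classical
  suffices H : ∀ s : Finset κ, ∃ v : V, v ≠ 0 ∧ ∀ k ∈ s, N k v = ((x k : ℤ) : ℂ) • v by
    obtain ⟨v, hv, h⟩ := H Finset.univ
    exact ⟨v, hv, fun k => h k (Finset.mem_univ k)⟩
  intro s
  induction s using Finset.induction_on with
  | empty => obtain ⟨v, hv⟩ := exists_ne (0 : V); exact ⟨v, hv, by simp⟩
  | insert m s hm ih =>
    obtain ⟨v, hv, h⟩ := ih
    have hxx : ((x m : ℤ) : ℂ) * ((x m : ℤ) : ℂ) = 1 := by
      rcases Int.units_eq_one_or (x m) with h | h <;> simp [h]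
    -- `v + x N v` is twice the projection of `v` to the wanted eigenspace. If it vanishes, `v` lies
    -- in the opposite eigenspace and `X m` flips it without disturbing the other modes.
    by_cases hw : v + ((x m : ℤ) : ℂ) • N m v = 0
    · have hNv : N m v = -((x m : ℤ) : ℂ) • v := by
        have := congrArg (((x m : ℤ) : ℂ) • ·) hw
        simp only [smul_add, smul_smul, hxx, one_smul, smul_zero] at this
        rw [neg_smul]
        exact eq_neg_of_add_eq_zero_right this
      refine ⟨X m v, fun h0 => hv ?_, fun k hk => ?_⟩
      · have := LinearMap.congr_fun (hX m) v
        simpa [h0] using this.symm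
      · rcases Finset.mem_insert.1 hk with rfl | hk
        · have := LinearMap.congr_fun (hXN k) v
          simp only [Module.End.mul_apply, LinearMap.neg_apply, hNv, map_smul, neg_smul,
            map_neg, neg_inj] at this
          exact this.symm
        · have := LinearMap.congr_fun (hXN' m k (by rintro rfl; exact hm hk)) v
          simp only [Module.End.mul_apply, h k hk, map_smul] at this
          exact this.symm
    · refine ⟨_, hw, fun k hk => ?_⟩
      rcases Finset.mem_insert.1 hk with rfl | hk
      · have := LinearMap.congr_fun (hN k) v
        simp only [Module.End.mul_apply, Module.End.one_apply] at this
        rw [map_add, map_smul, this, smul_add, smul_smul, hxx, one_smul, add_comm]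
      · have := LinearMap.congr_fun (hNN k m) v
        simp only [Module.End.mul_apply, h k hk, map_smul] at this
        rw [map_add, map_smul, this, h k hk]
        module

/-- The eigenvalues of a free-fermion Hamiltonian in diagonal form. -/
theorem exists_eigenvector_of_car {κ V : Type*} [Fintype κ] [DecidableEq κ] [AddCommGroup V]
    [Module ℂ V] [Nontrivial V] (p q : κ → Module.End ℂ V)
    (hpp : ∀ k l, p k * p l + p l * p k = 0) (hqq : ∀ k l, q k * q l + q l * q k = 0)
    (hpq : ∀ k l, p k * q l + q l * p k = if k = l then 1 else 0) (μ : κ → ℂ) (x : κ → ℤˣ) :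
    ∃ v : V, v ≠ 0 ∧ (∑ k, μ k • (2 * (p k * q k) - 1)) v = (∑ k, ((x k : ℤ) : ℂ) * μ k) • v := by
  have p2 (k) : p k * p k = 0 := sq_eq_zero_of_anticomm (hpp k k)
  have q2 (k) : q k * q k = 0 := sq_eq_zero_of_anticomm (hqq k k)
  have qp (k) : q k * p k = 1 - p k * q k := by
    rw [eq_sub_iff_add_eq, add_comm]; simpa using hpq k k
  have pp (k l) : p k * p l = -(p l * p k) := eq_neg_of_add_eq_zero_left (hpp k l)
  have qq (k l) : q k * q l = -(q l * q k) := eq_neg_of_add_eq_zero_left (hqq k l)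
  have pq {k l} (h : k ≠ l) : p k * q l = -(q l * p k) :=
    eq_neg_of_add_eq_zero_left (by simpa [h] using hpq k l)
  have hcomm {k l} (h : k ≠ l) : Commute (p k) (p l * q l) ∧ Commute (q k) (p l * q l) := by
    constructor
    · calc p k * (p l * q l) = (p k * p l) * q l := by noncomm_ring
        _ = -(p l * (p k * q l)) := by rw [pp k l]; noncomm_ring
        _ = p l * q l * p k := by rw [pq h]; noncomm_ring
    · calc q k * (p l * q l) = (q k * p l) * q l := by noncomm_ring
        _ = -(p l * (q k * q l)) := by
          rw [← neg_neg (q k * p l), ← pq h.symm]; noncomm_ring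
        _ = p l * q l * q k := by rw [qq k l]; noncomm_ring
  have hn (k) : (p k * q k) * (p k * q k) = p k * q k := by
    calc (p k * q k) * (p k * q k) = p k * (q k * p k) * q k := by noncomm_ring
      _ = p k * q k - (p k * p k) * (q k * q k) := by rw [qp]; noncomm_ring
      _ = p k * q k := by rw [p2, zero_mul, sub_zero]
  have hp (k) : p k * (p k * q k) = 0 := by rw [← mul_assoc, p2, zero_mul]
  have hq (k) : (p k * q k) * q k = 0 := by rw [mul_assoc, q2, mul_zero]
  have hp' (k) : (p k * q k) * p k = p k := by
    rw [mul_assoc, qp, mul_sub, hp, mul_one, sub_zero]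
  have hq' (k) : q k * (p k * q k) = q k := by
    rw [← mul_assoc, qp, sub_mul, hq, one_mul, sub_zero]
  obtain ⟨v, hv, h⟩ := exists_joint_eigenvector (fun k => 2 * (p k * q k) - 1)
    (fun k => p k + q k) (fun k => by
      calc _ = 4 * ((p k * q k) * (p k * q k)) - 4 * (p k * q k) + 1 := by noncomm_ring
        _ = 1 := by rw [hn]; noncomm_ring)
    (fun k l => by
      by_cases hkl : k = l
      · rw [hkl]
      · have : (p k * q k) * (p l * q l) = (p l * q l) * (p k * q k) :=
          (hcomm hkl).1.mul_left (hcomm hkl).2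
        calc _ = 4 * ((p k * q k) * (p l * q l)) - 2 * (p k * q k) - 2 * (p l * q l) + 1 := by
              noncomm_ring
          _ = _ := by rw [this]; noncomm_ring)
    (fun k => by
      calc (p k + q k) * (p k + q k) = p k * p k + q k * q k + p k * q k + q k * p k := by
            noncomm_ring
        _ = 1 := by rw [p2, q2, qp]; noncomm_ring)
    (fun k => by
      calc (p k + q k) * (2 * (p k * q k) - 1) =
            2 * (p k * (p k * q k)) + 2 * (q k * (p k * q k)) - p k - q k := by noncomm_ring
        _ = q k - p k := by rw [hp, hq']; noncomm_ring
        _ = -(2 * ((p k * q k) * p k) + 2 * ((p k * q k) * q k) - p k - q k) := by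
            rw [hp', hq]; noncomm_ring
        _ = _ := by noncomm_ring)
    (fun k l hkl => by
      have h1 : (p k + q k) * (p l * q l) = p l * q l * (p k + q k) :=
        (hcomm hkl).1.add_left (hcomm hkl).2
      calc _ = 2 * ((p k + q k) * (p l * q l)) - (p k + q k) := by noncomm_ring
        _ = _ := by rw [h1]; noncomm_ring) x
  refine ⟨v, hv, ?_⟩
  simp only [LinearMap.sum_apply, LinearMap.smul_apply, Finset.sum_smul] at h ⊢
  exact Finset.sum_congr rfl fun k _ => by rw [h, smul_smul, mul_comm]

/-! ### Plane-wave diagonalization of the quadratic form. -/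

section Diagonalization
variable {n : ℕ} [NeZero n]

/-- Coefficients of the `k`-th annihilation operator in the Majorana operators. -/
noncomputable def modeCoeff (ε : ℝ) (k : ZMod n) : ZMod n ⊕ ZMod n → ℂ :=
  Sum.elim (fun j => ZMod.stdAddChar (j * k))
    (fun j => Complex.I * modeEnergy ε k * ZMod.stdAddChar (j * k))

/-- Coefficients of the adjoint of the `k`-th annihilation operator in the Majorana operators. -/
noncomputable def modeCoeffConj (ε : ℝ) (k : ZMod n) : ZMod n ⊕ ZMod n → ℂ :=
  Sum.elim (fun j => ZMod.stdAddChar (-(j * k)))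
    (fun j => -Complex.I * modeEnergy ε k * ZMod.stdAddChar (-(j * k)))

theorem modeEnergy_mul_neg_complex (ε : ℝ) (k : ZMod n) :
    (modeEnergy ε k : ℂ) * modeEnergy ε (-k) = 1 := by
  exact_mod_cast congrArg (fun x : ℝ => (x : ℂ)) (modeEnergy_mul_neg ε k)

/-- Plane waves are orthogonal unless `l = -k`, and there the prefactor `1 - μ_k μ_{-k}` vanishes.
-/
theorem sum_modeCoeff_mul_modeCoeff (ε : ℝ) (k l : ZMod n) :
    ∑ i, modeCoeff ε k i * modeCoeff ε l i = 0 := by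
  have h : ∑ i, modeCoeff ε k i * modeCoeff ε l i =
      (1 - (modeEnergy ε k : ℂ) * modeEnergy ε l) * ∑ j, ZMod.stdAddChar (j * (k + l)) := by
    rw [Fintype.sum_sum_type, Finset.mul_sum, ← Finset.sum_add_distrib]
    refine Finset.sum_congr rfl fun j _ => ?_
    rw [mul_add, AddChar.map_add_eq_mul]
    simp only [modeCoeff, Sum.elim_inl, Sum.elim_inr]
    linear_combination (modeEnergy ε k * modeEnergy ε l *
      (ZMod.stdAddChar (j * k) * ZMod.stdAddChar (j * l)) : ℂ) * Complex.I_sq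
  rw [h, sum_stdAddChar_mul]
  split_ifs with hkl
  · rw [eq_neg_of_add_eq_zero_right hkl, modeEnergy_mul_neg_complex]; simp
  · simp

theorem sum_modeCoeffConj_mul_modeCoeffConj (ε : ℝ) (k l : ZMod n) :
    ∑ i, modeCoeffConj ε k i * modeCoeffConj ε l i = 0 := by
  have h : ∑ i, modeCoeffConj ε k i * modeCoeffConj ε l i =
      (1 - (modeEnergy ε k : ℂ) * modeEnergy ε l) * ∑ j, ZMod.stdAddChar (j * -(k + l)) := by
    rw [Fintype.sum_sum_type, Finset.mul_sum, ← Finset.sum_add_distrib]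
    refine Finset.sum_congr rfl fun j _ => ?_
    rw [neg_add, mul_add, AddChar.map_add_eq_mul, mul_neg, mul_neg]
    simp only [modeCoeffConj, Sum.elim_inl, Sum.elim_inr]
    linear_combination (modeEnergy ε k * modeEnergy ε l *
      (ZMod.stdAddChar (-(j * k)) * ZMod.stdAddChar (-(j * l))) : ℂ) * Complex.I_sq
  rw [h, sum_stdAddChar_mul]
  split_ifs with hkl
  · rw [eq_neg_of_add_eq_zero_right (neg_eq_zero.1 hkl), modeEnergy_mul_neg_complex]; simp
  · simp

theorem sum_modeCoeffConj_mul_modeCoeff (ε : ℝ) (k l : ZMod n) :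
    ∑ i, modeCoeffConj ε k i * modeCoeff ε l i =
      if k = l then (n : ℂ) * (1 + modeEnergy ε k ^ 2) else 0 := by
  have h : ∑ i, modeCoeffConj ε k i * modeCoeff ε l i =
      (1 + (modeEnergy ε k : ℂ) * modeEnergy ε l) * ∑ j, ZMod.stdAddChar (j * (l - k)) := by
    rw [Fintype.sum_sum_type, Finset.mul_sum, ← Finset.sum_add_distrib]
    refine Finset.sum_congr rfl fun j _ => ?_
    rw [sub_eq_add_neg, mul_add, AddChar.map_add_eq_mul, mul_neg]
    simp only [modeCoeffConj, modeCoeff, Sum.elim_inl, Sum.elim_inr]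
    linear_combination (-modeEnergy ε k * modeEnergy ε l *
      (ZMod.stdAddChar (-(j * k)) * ZMod.stdAddChar (j * l)) : ℂ) * Complex.I_sq
  rw [h, sum_stdAddChar_mul]
  simp only [sub_eq_zero, eq_comm (a := l)]
  split_ifs with hkl
  · subst hkl; ring
  · simp

/-- The coefficients of the quadratic form `ε XY + Z` in the Majorana operators. -/
noncomputable def chainCoeff (ε : ℝ) : ZMod n ⊕ ZMod n → ZMod n ⊕ ZMod n → ℂ
  | .inl j, .inr l => if j = l then Complex.I else 0
  | .inr j, .inr l => if l = j + 1 then Complex.I * ε else 0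
  | _, _ => 0

/-- The coefficients of the diagonalized quadratic form in the Majorana operators. -/
noncomputable def diagCoeff (ε : ℝ) (i i' : ZMod n ⊕ ZMod n) : ℂ :=
  ∑ k, modeEnergy ε k / (n * (1 + modeEnergy ε k ^ 2)) * (modeCoeffConj ε k i * modeCoeff ε k i')

theorem one_add_modeEnergy_sq_ne_zero (ε : ℝ) (k : ZMod n) :
    (1 + modeEnergy ε k ^ 2 : ℂ) ≠ 0 := by
  have : (1 + modeEnergy ε k ^ 2 : ℝ) ≠ 0 := by positivity
  exact_mod_cast this

theorem sum_sub_sum_neg_stdAddChar (g : ZMod n → ℂ) (d : ZMod n) :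
    ∑ k, g k * ZMod.stdAddChar (k * d) - ∑ k, g k * ZMod.stdAddChar (-(k * d)) =
      ∑ k, (g k - g (-k)) * ZMod.stdAddChar (k * d) := by
  conv_lhs => enter [2]; rw [← Equiv.sum_comp (Equiv.neg (ZMod n))]
  simp [sub_mul]

/-- The weight is `1/(n (μ + μ⁻¹))`, and `μ_{-k} = μ_k⁻¹`. -/
theorem diagWeight_neg (ε : ℝ) (k : ZMod n) :
    (modeEnergy ε (-k) : ℂ) / (n * (1 + modeEnergy ε (-k) ^ 2)) =
      modeEnergy ε k / (n * (1 + modeEnergy ε k ^ 2)) := by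
  have hn : (n : ℂ) ≠ 0 := NeZero.ne _
  rw [div_eq_div_iff (mul_ne_zero hn (one_add_modeEnergy_sq_ne_zero ε _))
    (mul_ne_zero hn (one_add_modeEnergy_sq_ne_zero ε _))]
  linear_combination n * (modeEnergy ε k - modeEnergy ε (-k) : ℂ) *
    modeEnergy_mul_neg_complex ε k

theorem diagWeight_mul_add (ε : ℝ) (k : ZMod n) :
    (modeEnergy ε k : ℂ) / (n * (1 + modeEnergy ε k ^ 2)) *
      (modeEnergy ε k + modeEnergy ε (-k)) = (n : ℂ)⁻¹ := by
  have hn : (n : ℂ) ≠ 0 := NeZero.ne _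
  have h := one_add_modeEnergy_sq_ne_zero ε k
  field_simp
  linear_combination modeEnergy_mul_neg_complex ε k

/-- In `(μ_k - μ_{-k})(μ_k + μ_{-k})` the second factor cancels the weight up to `1/n`, while the
first, `2ε sin`, is the Fourier symbol of the nearest-neighbour coupling. -/
theorem diagWeight_mul_sq_sub (ε : ℝ) (k : ZMod n) :
    (modeEnergy ε k : ℂ) / (n * (1 + modeEnergy ε k ^ 2)) *
      (modeEnergy ε k ^ 2 - modeEnergy ε (-k) ^ 2) = (n : ℂ)⁻¹ *
      (-Complex.I * ε * (ZMod.stdAddChar k - ZMod.stdAddChar (-k))) := by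
  have h : (modeEnergy ε k - modeEnergy ε (-k) : ℂ) = 2 * ε * sineAt k := by
    exact_mod_cast congrArg (fun x : ℝ => (x : ℂ)) (modeEnergy_sub_neg ε k)
  rw [← diagWeight_mul_add ε k]
  linear_combination (modeEnergy ε k / (n * (1 + modeEnergy ε k ^ 2)) *
    (modeEnergy ε k + modeEnergy ε (-k)) : ℂ) * (h + ε * two_mul_sineAt k)

theorem diagCoeff_inl_inl (ε : ℝ) (j l : ZMod n) : diagCoeff ε (.inl j) (.inl l) =
    ∑ k, (modeEnergy ε k : ℂ) / (n * (1 + modeEnergy ε k ^ 2)) *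
      ZMod.stdAddChar (k * (l - j)) := by
  refine Finset.sum_congr rfl fun k _ => ?_
  rw [show k * (l - j) = -(j * k) + l * k by ring, AddChar.map_add_eq_mul]
  simp only [modeCoeffConj, modeCoeff, Sum.elim_inl]

theorem diagCoeff_inl_inr (ε : ℝ) (j l : ZMod n) : diagCoeff ε (.inl j) (.inr l) =
    ∑ k, Complex.I * ((modeEnergy ε k : ℂ) / (n * (1 + modeEnergy ε k ^ 2)) * modeEnergy ε k) *
      ZMod.stdAddChar (k * (l - j)) := by
  refine Finset.sum_congr rfl fun k _ => ?_
  rw [show k * (l - j) = -(j * k) + l * k by ring, AddChar.map_add_eq_mul]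
  simp only [modeCoeffConj, modeCoeff, Sum.elim_inl, Sum.elim_inr]
  ring

theorem diagCoeff_inr_inl (ε : ℝ) (j l : ZMod n) : diagCoeff ε (.inr j) (.inl l) =
    -∑ k, Complex.I * ((modeEnergy ε k : ℂ) / (n * (1 + modeEnergy ε k ^ 2)) * modeEnergy ε k) *
      ZMod.stdAddChar (k * (l - j)) := by
  rw [← Finset.sum_neg_distrib]
  refine Finset.sum_congr rfl fun k _ => ?_
  rw [show k * (l - j) = -(j * k) + l * k by ring, AddChar.map_add_eq_mul]
  simp only [modeCoeffConj, modeCoeff, Sum.elim_inl, Sum.elim_inr]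
  ring

theorem diagCoeff_inr_inr (ε : ℝ) (j l : ZMod n) : diagCoeff ε (.inr j) (.inr l) =
    ∑ k, (modeEnergy ε k : ℂ) / (n * (1 + modeEnergy ε k ^ 2)) * modeEnergy ε k ^ 2 *
      ZMod.stdAddChar (k * (l - j)) := by
  refine Finset.sum_congr rfl fun k _ => ?_
  rw [show k * (l - j) = -(j * k) + l * k by ring, AddChar.map_add_eq_mul]
  simp only [modeCoeffConj, modeCoeff, Sum.elim_inr]
  linear_combination (-((modeEnergy ε k : ℂ) / (n * (1 + modeEnergy ε k ^ 2)) *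
    modeEnergy ε k ^ 2 * (ZMod.stdAddChar (-(j * k)) * ZMod.stdAddChar (l * k)))) * Complex.I_sq

theorem diagCoeff_sub_swap_inl_inr (ε : ℝ) (j l : ZMod n) :
    diagCoeff ε (.inl j) (.inr l) - diagCoeff ε (.inr l) (.inl j) =
      if j = l then Complex.I else 0 := by
  have hn : (n : ℂ) ≠ 0 := NeZero.ne _
  rw [diagCoeff_inl_inr, diagCoeff_inr_inl]
  conv_lhs => enter [2]; rw [← Equiv.sum_comp (Equiv.neg (ZMod n))]
  rw [sub_neg_eq_add, ← Finset.sum_add_distrib]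
  trans ∑ k, (Complex.I * (n : ℂ)⁻¹) * ZMod.stdAddChar (k * (l - j))
  · refine Finset.sum_congr rfl fun k _ => ?_
    rw [← diagWeight_mul_add ε k, Equiv.neg_apply, diagWeight_neg,
      show -k * (j - l) = k * (l - j) by ring]
    ring
  · rw [← Finset.mul_sum, sum_stdAddChar_mul]
    simp only [sub_eq_zero, eq_comm (a := l)]
    split_ifs
    · rw [mul_assoc, inv_mul_cancel₀ hn, mul_one]
    · simp

/-- By the Clifford relations only antisymmetric parts matter, up to a scalar. The `aa` block
cancels because the weight is even in `k`; Fourier inversion gives the on-site term in the `ab`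
block and the neighbour coupling in the `bb` block. -/
theorem diagCoeff_sub_swap (ε : ℝ) (i i' : ZMod n ⊕ ZMod n) :
    diagCoeff ε i i' - diagCoeff ε i' i = chainCoeff ε i i' - chainCoeff ε i' i := by
  have hn : (n : ℂ) ≠ 0 := NeZero.ne _
  rcases i with j | j <;> rcases i' with l | l
  · rw [diagCoeff_inl_inl, diagCoeff_inl_inl]
    simp only [show ∀ k : ZMod n, k * (j - l) = -(k * (l - j)) from fun k => by ring]
    rw [sum_sub_sum_neg_stdAddChar]
    simp [diagWeight_neg, chainCoeff]
  · rw [diagCoeff_sub_swap_inl_inr]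
    simp [chainCoeff]
  · rw [← neg_sub, diagCoeff_sub_swap_inl_inr]
    simp [chainCoeff]
  · rw [diagCoeff_inr_inr, diagCoeff_inr_inr]
    simp only [show ∀ k : ZMod n, k * (j - l) = -(k * (l - j)) from fun k => by ring]
    rw [sum_sub_sum_neg_stdAddChar]
    simp_rw [diagWeight_neg, ← mul_sub, diagWeight_mul_sq_sub]
    trans (n : ℂ)⁻¹ * (-Complex.I * ε) * (∑ k : ZMod n, ZMod.stdAddChar (k * (l - j + 1)) -
      ∑ k : ZMod n, ZMod.stdAddChar (k * (l - j - 1)))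
    · rw [← Finset.sum_sub_distrib, Finset.mul_sum]
      refine Finset.sum_congr rfl fun k _ => ?_
      rw [mul_add, mul_one, sub_eq_add_neg (l - j) 1, mul_add, mul_neg, mul_one,
        AddChar.map_add_eq_mul, AddChar.map_add_eq_mul]
      ring
    · rw [sum_stdAddChar_mul, sum_stdAddChar_mul]
      have e1 : l - j + 1 = 0 ↔ j = l + 1 := by
        constructor <;> intro h
        · linear_combination -h
        · rw [h]; ring
      have e2 : l - j - 1 = 0 ↔ l = j + 1 := by
        constructor <;> intro h
        · linear_combination h
        · rw [h]; ring
      simp only [e1, e2, chainCoeff]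
      split_ifs <;> field_simp <;> ring

theorem sum_diagCoeff_self (ε : ℝ) :
    ∑ i : ZMod n ⊕ ZMod n, diagCoeff ε i i = ∑ k : ZMod n, (modeEnergy ε k : ℂ) := by
  have hn : (n : ℂ) ≠ 0 := NeZero.ne _
  unfold diagCoeff
  rw [Finset.sum_comm]
  refine Finset.sum_congr rfl fun k _ => ?_
  rw [← Finset.mul_sum, sum_modeCoeffConj_mul_modeCoeff, if_pos rfl,
    div_mul_cancel₀ _ (mul_ne_zero hn (one_add_modeEnergy_sq_ne_zero ε k))]

omit [NeZero n] in
theorem chainCoeff_self (h1 : (1 : ZMod n) ≠ 0) (ε : ℝ) (i : ZMod n ⊕ ZMod n) :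
    chainCoeff ε i i = 0 := by
  rcases i with j | j <;> simp [chainCoeff, h1]

/-- The eigenvalues of the translation invariant quadratic form `i ∑ (a_j b_j + ε b_j b_{j+1})` in
Majorana operators. -/
theorem exists_eigenvector_of_majorana {V : Type*} [AddCommGroup V] [Module ℂ V] [Nontrivial V]
    (h1 : (1 : ZMod n) ≠ 0) (γ : ZMod n ⊕ ZMod n → Module.End ℂ V)
    (hγ : ∀ i j, γ i * γ j + γ j * γ i = if i = j then 2 else 0) (ε : ℝ) (x : ZMod n → ℤˣ) :
    ∃ v : V, v ≠ 0 ∧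
      (∑ j, (Complex.I • (γ (.inl j) * γ (.inr j)) +
        (Complex.I * ε) • (γ (.inr j) * γ (.inr (j + 1))))) v =
      (∑ k, ((x k : ℤ) : ℂ) * modeEnergy ε k) • v := by
  have hn : (n : ℂ) ≠ 0 := NeZero.ne _
  -- The scalar inverts the anticommutator `2n(1 + μ_k²)` of the unnormalized modes.
  set p : ZMod n → Module.End ℂ V := fun k =>
    (2 * (n * (1 + modeEnergy ε k ^ 2)) : ℂ)⁻¹ • ∑ i, modeCoeffConj ε k i • γ i with hp
  set q : ZMod n → Module.End ℂ V := fun k => ∑ i, modeCoeff ε k i • γ i with hq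
  obtain ⟨v, hv, h⟩ := exists_eigenvector_of_car p q
    (fun k l => by
      have := smul_sum_anticomm hγ (modeCoeffConj ε k) (modeCoeffConj ε l)
      rw [sum_modeCoeffConj_mul_modeCoeffConj, mul_zero, map_zero] at this
      simp only [hp, smul_mul_smul_comm]
      rw [mul_comm (_ : ℂ)⁻¹ (_ : ℂ)⁻¹, ← smul_add, this, smul_zero])
    (fun k l => by
      have := smul_sum_anticomm hγ (modeCoeff ε k) (modeCoeff ε l)
      rwa [sum_modeCoeff_mul_modeCoeff, mul_zero, map_zero] at this)
    (fun k l => by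
      have := smul_sum_anticomm hγ (modeCoeffConj ε k) (modeCoeff ε l)
      rw [sum_modeCoeffConj_mul_modeCoeff] at this
      simp only [hp, smul_mul_assoc, mul_smul_comm]
      rw [← smul_add, this]
      split_ifs
      · rw [Algebra.algebraMap_eq_smul_one, smul_smul, inv_mul_cancel₀, one_smul]
        exact mul_ne_zero two_ne_zero (mul_ne_zero hn (one_add_modeEnergy_sq_ne_zero ε k))
      · simp)
    (fun k => (modeEnergy ε k : ℂ)) x
  refine ⟨v, hv, ?_⟩
  rw [← h]
  congr 1
  have hd : ∑ i, ∑ i', diagCoeff ε i i' • (γ i * γ i') =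
      ∑ k, (modeEnergy ε k / (n * (1 + modeEnergy ε k ^ 2)) : ℂ) •
        ((∑ i, modeCoeffConj ε k i • γ i) * ∑ i, modeCoeff ε k i • γ i) := by
    simp_rw [Finset.sum_mul_sum, smul_mul_smul_comm, Finset.smul_sum, smul_smul]
    rw [Finset.sum_comm]
    rw [Finset.sum_comm (s := (Finset.univ : Finset (ZMod n)))]
    rw [Finset.sum_comm]
    refine Finset.sum_congr rfl fun i _ => ?_
    rw [Finset.sum_comm]
    refine Finset.sum_congr rfl fun i' _ => ?_
    rw [← Finset.sum_smul]
    rfl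
  have hc : ∑ i, ∑ i', chainCoeff ε i i' • (γ i * γ i') =
      ∑ j, (Complex.I • (γ (.inl j) * γ (.inr j)) +
        (Complex.I * ε) • (γ (.inr j) * γ (.inr (j + 1)))) := by
    simp [Fintype.sum_sum_type, chainCoeff, ite_smul, Finset.sum_add_distrib]
  -- The trace of `diagCoeff` is `∑ μ_k`, exactly the constant supplied by the `-1` in `2 p_k q_k -
  -- 1`.
  have hmain := sum_smul_mul_eq_of_antisymm hγ _ _ (diagCoeff_sub_swap ε)
  rw [hd, hc, sum_diagCoeff_self] at hmain
  simp only [chainCoeff_self h1, Finset.sum_const_zero, sub_zero] at hmain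
  rw [← sub_eq_iff_eq_add] at hmain
  rw [← hmain, map_sum, ← Finset.sum_sub_distrib]
  refine Finset.sum_congr rfl fun k _ => ?_
  have h2 : (2 : Module.End ℂ V) = (2 : ℂ) • 1 := by
    rw [two_smul, one_add_one_eq_two]
  rw [hp, hq, smul_sub, Algebra.algebraMap_eq_smul_one]
  simp only [h2, smul_mul_assoc, one_mul, smul_smul]
  congr 2
  have := one_add_modeEnergy_sq_ne_zero ε k
  field_simp

end Diagonalization

/-! ### Tensor products of one-site matrices and the reflection of the sites. -/

section Tensor
variable {n : ℕ}

theorem tensorMatrix_mul (A B : Fin n → Matrix (Fin 2) (Fin 2) ℂ) :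
    tensorMatrix A * tensorMatrix B = tensorMatrix fun k => A k * B k := by
  ext x y
  simp only [tensorMatrix, Matrix.mul_apply, Matrix.of_apply]
  rw [Finset.prod_univ_sum, Fintype.piFinset_univ]
  simp_rw [Finset.prod_mul_distrib]

theorem tensorMatrix_one : tensorMatrix (fun _ : Fin n => 1) = 1 := by
  ext x y
  simp only [tensorMatrix, Matrix.of_apply, Matrix.one_apply, Finset.prod_ite_zero,
    Finset.mem_univ, true_implies, Finset.prod_const_one, funext_iff]

theorem tensorMatrix_eq_smul {A B : Fin n → Matrix (Fin 2) (Fin 2) ℂ} (c : ℂ) (j : Fin n)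
    (hj : A j = c • B j) (h : ∀ k ≠ j, A k = B k) : tensorMatrix A = c • tensorMatrix B := by
  ext x y
  simp only [tensorMatrix, Matrix.of_apply, Matrix.smul_apply, smul_eq_mul]
  rw [← Finset.mul_prod_erase _ _ (Finset.mem_univ j),
    ← Finset.mul_prod_erase _ (fun k => B k (x k) (y k)) (Finset.mem_univ j), hj, ← mul_assoc,
    Matrix.smul_apply, smul_eq_mul]
  congr 1
  exact Finset.prod_congr rfl fun k hk => by rw [h k (Finset.ne_of_mem_erase hk)]

theorem tensorMatrix_mul_comm {A B : Fin n → Matrix (Fin 2) (Fin 2) ℂ} (c : ℂ) (j : Fin n)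
    (hj : A j * B j = c • (B j * A j)) (h : ∀ k ≠ j, A k * B k = B k * A k) :
    tensorMatrix A * tensorMatrix B = c • (tensorMatrix B * tensorMatrix A) := by
  rw [tensorMatrix_mul, tensorMatrix_mul]
  exact tensorMatrix_eq_smul c j hj h

theorem siteSigma_mul_tensorMatrix {a b : Fin 4} {c : ℂ} {j : Fin n}
    {u : Fin n → Matrix (Fin 2) (Fin 2) ℂ} (h : pauli a * u j = c • (u j * pauli b)) :
    siteSigma a j * tensorMatrix u = c • (tensorMatrix u * siteSigma b j) := by
  rw [siteSigma, siteSigma, tensorMatrix_mul, tensorMatrix_mul]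
  refine tensorMatrix_eq_smul c j (by simpa using h) fun k hk => by simp [hk]

/-- The permutation matrix reversing the order of the sites. -/
noncomputable def reflection (n : ℕ) : Matrix (Fin n → Fin 2) (Fin n → Fin 2) ℂ :=
  Matrix.of fun x y => if y = x ∘ Fin.rev then 1 else 0

theorem comp_rev_eq_iff (x y : Fin n → Fin 2) : y = x ∘ Fin.rev ↔ x = y ∘ Fin.rev := by
  constructor <;> rintro rfl <;> ext k <;> simp

theorem tensorMatrix_mul_reflection (A : Fin n → Matrix (Fin 2) (Fin 2) ℂ) :
    tensorMatrix A * reflection n = reflection n * tensorMatrix (A ∘ Fin.rev) := by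
  ext x y
  simp only [Matrix.mul_apply, reflection, Matrix.of_apply, comp_rev_eq_iff _ y]
  simp only [mul_ite, mul_one, mul_zero, ite_mul, one_mul, zero_mul, Finset.sum_ite_eq',
    Finset.mem_univ, if_true]
  simp only [tensorMatrix, Matrix.of_apply]
  refine Fintype.prod_equiv Fin.revPerm _ _ fun k => ?_
  simp

theorem reflection_mul_reflection : reflection n * reflection n = 1 := by
  ext x y
  simp only [Matrix.mul_apply, reflection, Matrix.of_apply, Matrix.one_apply]
  simp only [ite_mul, one_mul, zero_mul, Finset.sum_ite_eq', Finset.mem_univ, if_true]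
  congr 1
  rw [comp_rev_eq_iff, eq_iff_iff]
  constructor
  · intro h; funext k; have := congrFun h k.rev; simpa using this
  · rintro rfl; rfl

theorem siteSigma_mul_reflection (a : Fin 4) (j : Fin n) :
    siteSigma a j * reflection n = reflection n * siteSigma a j.rev := by
  rw [siteSigma, tensorMatrix_mul_reflection, siteSigma]
  congr 2
  funext k
  simp only [Function.comp_apply, Function.update_apply, Fin.rev_eq_iff]

end Tensor

section Pauli

theorem pauli_one_mul_two : pauli 1 * pauli 2 = Complex.I • pauli 3 := by
  ext i j; fin_cases i <;> fin_cases j <;> simp [pauli]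

theorem pauli_two_mul_one : pauli 2 * pauli 1 = -Complex.I • pauli 3 := by
  ext i j; fin_cases i <;> fin_cases j <;> simp [pauli]

theorem pauli_two_mul_three : pauli 2 * pauli 3 = Complex.I • pauli 1 := by
  ext i j; fin_cases i <;> fin_cases j <;> simp [pauli]

theorem pauli_three_mul_two : pauli 3 * pauli 2 = -Complex.I • pauli 1 := by
  ext i j; fin_cases i <;> fin_cases j <;> simp [pauli]

theorem pauli_one_mul_three : pauli 1 * pauli 3 = -Complex.I • pauli 2 := by
  ext i j; fin_cases i <;> fin_cases j <;> simp [pauli]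

theorem pauli_three_mul_one : pauli 3 * pauli 1 = Complex.I • pauli 2 := by
  ext i j; fin_cases i <;> fin_cases j <;> simp [pauli]

theorem pauli_mul_self (a : Fin 4) : pauli a * pauli a = 1 := by
  fin_cases a <;> ext i j <;> fin_cases i <;> fin_cases j <;> simp [pauli]

end Pauli

/-! ### Jordan-Wigner strings, parity and Majorana operators. -/

section JordanWigner
variable {n : ℕ}

/-- The Jordan-Wigner operator with a Pauli matrix at site `j` and a string of `σ⁽³⁾` before it. -/
noncomputable def jordanWigner (a : Fin 4) (j : Fin n) :
    Matrix (Fin n → Fin 2) (Fin n → Fin 2) ℂ :=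
  tensorMatrix fun k => if k < j then pauli 3 else if k = j then pauli a else 1

/-- The parity operator `∏ σ_j⁽³⁾`. -/
noncomputable def parity (n : ℕ) : Matrix (Fin n → Fin 2) (Fin n → Fin 2) ℂ :=
  tensorMatrix fun _ => pauli 3

theorem parity_mul_parity : parity n * parity n = 1 := by
  rw [parity, tensorMatrix_mul, pauli_mul_self, tensorMatrix_one]

theorem pauli_mul_three_anticomm {a : Fin 4} (ha : a = 1 ∨ a = 2) :
    pauli a * pauli 3 = (-1 : ℂ) • (pauli 3 * pauli a) := by
  rcases ha with rfl | rfl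
  · rw [pauli_one_mul_three, pauli_three_mul_one]; module
  · rw [pauli_two_mul_three, pauli_three_mul_two]; module

theorem parity_mul_jordanWigner {a : Fin 4} (ha : a = 1 ∨ a = 2) (j : Fin n) :
    jordanWigner a j * parity n = -(parity n * jordanWigner a j) := by
  rw [← neg_one_smul ℂ, parity, jordanWigner]
  refine tensorMatrix_mul_comm (-1) j ?_ fun k hk => ?_
  · simpa using pauli_mul_three_anticomm ha
  · simp only [hk, if_false]
    split_ifs <;> simp

theorem commute_parity_jordanWigner_mul {a b : Fin 4} (ha : a = 1 ∨ a = 2) (hb : b = 1 ∨ b = 2)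
    (j l : Fin n) : Commute (parity n) (jordanWigner a j * jordanWigner b l) := by
  have h1 := parity_mul_jordanWigner ha j
  have h2 := parity_mul_jordanWigner hb l
  rw [Commute, SemiconjBy, mul_assoc, h2, mul_neg, ← mul_assoc _ (parity n), h1, neg_mul, neg_neg,
    mul_assoc]

theorem jordanWigner_anticomm_of_lt {a b : Fin 4} (ha : a = 1 ∨ a = 2) {j l : Fin n}
    (h : j < l) :
    jordanWigner a j * jordanWigner b l = -(jordanWigner b l * jordanWigner a j) := by
  rw [← neg_one_smul ℂ, jordanWigner, jordanWigner]
  refine tensorMatrix_mul_comm (-1) j ?_ fun k hk => ?_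
  · simpa [h] using pauli_mul_three_anticomm ha
  · simp only [hk, if_false]
    by_cases h1 : k < j
    · simp [h1, h1.trans h]
    · simp [h1]

theorem jordanWigner_sq (a : Fin 4) (j : Fin n) : jordanWigner a j * jordanWigner a j = 1 := by
  rw [jordanWigner, tensorMatrix_mul, ← tensorMatrix_one]
  congr 1
  funext k
  split_ifs <;> simp [pauli_mul_self]

theorem jordanWigner_one_mul_two (j : Fin n) :
    jordanWigner 1 j * jordanWigner 2 j = Complex.I • siteSigma 3 j := by
  rw [jordanWigner, jordanWigner, tensorMatrix_mul, siteSigma]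
  refine tensorMatrix_eq_smul _ j (by simp [pauli_one_mul_two]) fun k hk => ?_
  simp only [hk, if_false, Function.update_of_ne hk]
  split_ifs <;> simp [pauli_mul_self]

theorem jordanWigner_two_mul_one (j : Fin n) :
    jordanWigner 2 j * jordanWigner 1 j = -Complex.I • siteSigma 3 j := by
  rw [jordanWigner, jordanWigner, tensorMatrix_mul, siteSigma]
  refine tensorMatrix_eq_smul _ j (by simp [pauli_two_mul_one]) fun k hk => ?_
  simp only [hk, if_false, Function.update_of_ne hk]
  split_ifs <;> simp [pauli_mul_self]

/-- The Majorana operators of the chain. -/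
noncomputable def majorana : Fin n ⊕ Fin n → Matrix (Fin n → Fin 2) (Fin n → Fin 2) ℂ :=
  Sum.elim (jordanWigner 1) (jordanWigner 2)

theorem majorana_anticomm (i j : Fin n ⊕ Fin n) :
    majorana i * majorana j + majorana j * majorana i = if i = j then 2 else 0 := by
  have key {a b : Fin 4} (ha : a = 1 ∨ a = 2) (hb : b = 1 ∨ b = 2) {j l : Fin n} (h : j ≠ l) :
      jordanWigner a j * jordanWigner b l + jordanWigner b l * jordanWigner a j = 0 := by
    rcases lt_or_gt_of_ne h with h | h
    · rw [jordanWigner_anticomm_of_lt ha h, neg_add_cancel]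
    · rw [jordanWigner_anticomm_of_lt hb h, add_neg_cancel]
  rcases i with i | i <;> rcases j with j | j <;> by_cases h : i = j <;>
    simp [majorana, h, key, jordanWigner_sq, jordanWigner_one_mul_two, jordanWigner_two_mul_one,
      one_add_one_eq_two]

end JordanWigner

/-! ### From the Majorana form back to the spin chain, sector by sector. -/

section Chain
variable {m : ℕ}

theorem siteSigma_mul_siteSigma {n : ℕ} (a b : Fin 4) (j l : Fin n) :
    siteSigma a j * siteSigma b l = tensorMatrix fun k =>
      Function.update (fun _ => 1) j (pauli a) k * Function.update (fun _ => 1) l (pauli b) k :=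
  tensorMatrix_mul _ _

theorem jordanWigner_two_mul_two {j : Fin (m + 1)} (hj : j ≠ Fin.last m) :
    jordanWigner 2 j * jordanWigner 2 (j + 1) =
      Complex.I • (siteSigma 1 j * siteSigma 2 (j + 1)) := by
  have hlt : j < j + 1 := by
    rw [Fin.lt_def, Fin.val_add_one, if_neg hj]; omega
  have hiff {k : Fin (m + 1)} (hk : k ≠ j) : k < j + 1 ↔ k < j := by
    rw [Fin.lt_def, Fin.lt_def, Fin.val_add_one, if_neg hj]
    have : k.val ≠ j.val := fun h => hk (Fin.ext h)
    omega
  rw [jordanWigner, jordanWigner, tensorMatrix_mul, siteSigma_mul_siteSigma]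
  refine tensorMatrix_eq_smul _ j ?_ fun k hk => ?_
  · simp [hlt, hlt.ne, pauli_two_mul_three]
  · simp only [hk, if_false, Function.update_of_ne hk, hiff hk, Function.update_apply, one_mul]
    by_cases h : k < j
    · have : k ≠ j + 1 := (h.trans hlt).ne
      simp [h, this, pauli_mul_self]
    · simp [h]

/-- Across the closing bond the string covers the whole ring and becomes the parity operator;
compared with the other bonds, the sign is reversed too. -/
theorem jordanWigner_last_mul_zero (hm : m ≠ 0) :
    jordanWigner 2 (Fin.last m) * jordanWigner 2 0 =
      -Complex.I • (siteSigma 1 (Fin.last m) * siteSigma 2 0 * parity (m + 1)) := by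
  have hl : Fin.last m ≠ 0 := by simpa [Fin.ext_iff] using hm
  rw [jordanWigner, jordanWigner, tensorMatrix_mul, siteSigma_mul_siteSigma, parity,
    tensorMatrix_mul]
  -- The sign comes from exchanging `σ⁽³⁾` and `σ⁽²⁾` at site `0`; what remains differs from the
  -- target only at the last site.
  trans (-1 : ℂ) • tensorMatrix fun k : Fin (m + 1) =>
    if k = 0 then pauli 2 * pauli 3 else if k = Fin.last m then pauli 2 else pauli 3
  · refine tensorMatrix_eq_smul _ 0 ?_ fun k hk => ?_
    · simp [Fin.pos_iff_ne_zero, hm, pauli_mul_three_anticomm]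
    · by_cases h : k = Fin.last m
      · simp [h, hl]
      · simp [h, hk, Fin.lt_last_iff_ne_last]
  · rw [neg_one_smul, neg_smul]
    congr 1
    refine tensorMatrix_eq_smul _ (Fin.last m) ?_ fun k hk => ?_
    · simp [hl, pauli_one_mul_three, smul_smul]
    · by_cases h : k = 0
      · simp [h, hl.symm]
      · simp [h, hk]

/-- The Hamiltonian with the coupling across the last bond multiplied by `s`. -/
noncomputable def twistedHam (m : ℕ) (ε : ℝ) (s : ℂ) :
    Matrix (Fin (m + 1) → Fin 2) (Fin (m + 1) → Fin 2) ℂ :=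
  ∑ j : Fin (m + 1), ((ε * if j = Fin.last m then s else 1 : ℂ) •
    (siteSigma 1 j * siteSigma 2 (j + 1)) + siteSigma 3 j)

theorem twistedHam_one (ε : ℝ) : twistedHam m ε 1 = hamXYplusZ (m + 1) ε := by
  simp [twistedHam, hamXYplusZ]

/-- The Hamiltonian with cyclic boundary conditions for the Majorana operators, up to sign. -/
noncomputable def majoranaHam (m : ℕ) (ε : ℝ) :
    Matrix (Fin (m + 1) → Fin 2) (Fin (m + 1) → Fin 2) ℂ :=
  ∑ j : Fin (m + 1), (Complex.I • (majorana (.inl j) * majorana (.inr j)) +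
    (Complex.I * ε : ℂ) • (majorana (.inr j) * majorana (.inr (j + 1))))

theorem commute_parity_majoranaHam (ε : ℝ) :
    Commute (parity (m + 1)) (majoranaHam m ε) := by
  refine Commute.sum_right _ _ _ fun j _ => Commute.add_right ?_ ?_
  · exact (commute_parity_jordanWigner_mul (.inl rfl) (.inr rfl) _ _).smul_right _
  · exact (commute_parity_jordanWigner_mul (.inr rfl) (.inr rfl) _ _).smul_right _

open Matrix in
theorem majoranaHam_mulVec (hm : m ≠ 0) (ε : ℝ) (s : ℂ) (v : (Fin (m + 1) → Fin 2) → ℂ)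
    (hv : parity (m + 1) *ᵥ v = s • v) :
    majoranaHam m ε *ᵥ v = -(twistedHam m ε (-s) *ᵥ v) := by
  simp only [majoranaHam, twistedHam, Matrix.sum_mulVec, ← Finset.sum_neg_distrib]
  refine Finset.sum_congr rfl fun j _ => ?_
  simp only [majorana, Sum.elim_inl, Sum.elim_inr, jordanWigner_one_mul_two, add_mulVec,
    smul_mulVec, smul_smul, Complex.I_mul_I]
  by_cases hj : j = Fin.last m
  · subst hj
    rw [Fin.last_add_one, jordanWigner_last_mul_zero hm, if_pos rfl, smul_mulVec,
      ← mulVec_mulVec, hv, mulVec_smul]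
    simp only [smul_smul, neg_add, ← neg_smul, neg_one_smul]
    rw [add_comm (-(siteSigma 3 _ *ᵥ v))]
    congr 2
    linear_combination (-(ε * s) : ℂ) * Complex.I_sq
  · rw [if_neg hj, jordanWigner_two_mul_two hj, smul_mulVec]
    simp only [smul_smul, neg_add, ← neg_smul, neg_one_smul]
    rw [add_comm (-(siteSigma 3 _ *ᵥ v))]
    congr 2
    linear_combination (ε : ℂ) * Complex.I_sq

/-- The local rotation about the third axis by alternating quarter turns. -/
noncomputable def quarterTurns (m : ℕ) :
    Matrix (Fin (m + 1) → Fin 2) (Fin (m + 1) → Fin 2) ℂ :=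
  tensorMatrix fun k => !![1, 0; 0, -(-1) ^ k.val * Complex.I]

theorem siteSigma_one_mul_quarterTurns (j : Fin (m + 1)) :
    siteSigma 1 j * quarterTurns m = ((-1) ^ j.val : ℂ) • (quarterTurns m * siteSigma 2 j) := by
  refine siteSigma_mul_tensorMatrix ?_
  rcases neg_one_pow_eq_or ℂ j.val with h | h <;> rw [h] <;> ext i j <;> fin_cases i <;>
    fin_cases j <;> simp [pauli]

theorem siteSigma_two_mul_quarterTurns (j : Fin (m + 1)) :
    siteSigma 2 j * quarterTurns m = (-(-1) ^ j.val : ℂ) • (quarterTurns m * siteSigma 1 j) := by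
  refine siteSigma_mul_tensorMatrix ?_
  rcases neg_one_pow_eq_or ℂ j.val with h | h <;> rw [h] <;> ext i j <;> fin_cases i <;>
    fin_cases j <;> simp [pauli]

theorem siteSigma_three_mul_quarterTurns (j : Fin (m + 1)) :
    siteSigma 3 j * quarterTurns m = quarterTurns m * siteSigma 3 j := by
  rw [← one_smul ℂ (quarterTurns m * _)]
  refine siteSigma_mul_tensorMatrix ?_
  ext i j; fin_cases i <;> fin_cases j <;> simp [pauli]

theorem exists_quarterTurns_left_inv : ∃ T, T * quarterTurns m = 1 := by
  refine ⟨tensorMatrix fun k => !![1, 0; 0, (-1) ^ k.val * Complex.I], ?_⟩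
  rw [quarterTurns, tensorMatrix_mul, ← tensorMatrix_one]
  congr 1
  funext k
  rcases neg_one_pow_eq_or ℂ k.val with h | h <;> rw [h] <;> ext i j <;> fin_cases i <;>
    fin_cases j <;> simp

theorem siteSigma_comm {n : ℕ} {j l : Fin n} (h : j ≠ l) (a b : Fin 4) :
    siteSigma a j * siteSigma b l = siteSigma b l * siteSigma a j := by
  rw [siteSigma_mul_siteSigma, siteSigma_mul_siteSigma]
  congr 1
  funext k
  by_cases h1 : k = j
  · subst h1; simp [h]
  · simp [h1]

theorem rev_eq_last_sub (k : Fin (m + 1)) : k.rev = Fin.last m - k := by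
  rw [eq_sub_iff_add_eq]
  ext
  rw [Fin.val_add, Fin.val_rev, Fin.val_last, Nat.mod_eq_of_lt] <;> omega

/-- The quarter turns exchange `σ⁽¹⁾` and `σ⁽²⁾`, with signs that multiply to `+1` on each interior
bond. The alternation fails to close up on a ring of odd length, so the last bond gets `-1`. The
reflection restores the order of the two Paulis and fixes the last bond. -/
theorem hamXYplusZ_mul_quarterTurns_mul_reflection (hm : m ≠ 0) (hm2 : Even m) (ε : ℝ) :
    hamXYplusZ (m + 1) ε * (quarterTurns m * reflection (m + 1)) =
      quarterTurns m * reflection (m + 1) * twistedHam m ε (-1) := by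
  have hrev (j : Fin (m + 1)) : (j + 1).rev + 1 = j.rev := by
    rw [rev_eq_last_sub, rev_eq_last_sub]; abel
  have hlast (j : Fin (m + 1)) : (j + 1).rev = Fin.last m ↔ j = Fin.last m := by
    rw [← Fin.rev_zero, Fin.rev_inj, Fin.rev_zero, ← Fin.last_add_one m, add_left_inj]
  have hne (j : Fin (m + 1)) : j ≠ j + 1 := by
    intro h
    have : (1 : Fin (m + 1)) = 0 := by simpa using h.symm
    exact hm (by simpa using this)
  have hbond (j : Fin (m + 1)) : siteSigma 1 j * siteSigma 2 (j + 1) * quarterTurns m =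
      (if j = Fin.last m then -1 else 1 : ℂ) •
        (quarterTurns m * (siteSigma 2 j * siteSigma 1 (j + 1))) := by
    rw [mul_assoc, siteSigma_two_mul_quarterTurns, mul_smul_comm, ← mul_assoc,
      siteSigma_one_mul_quarterTurns, smul_mul_assoc, smul_smul, mul_assoc]
    congr 1
    rw [Fin.val_add_one]
    split_ifs with h
    · simp [h, hm2.neg_one_pow]
    · rw [pow_succ]
      rcases neg_one_pow_eq_or ℂ j.val with h | h <;> rw [h] <;> norm_num
  have hrefl (j : Fin (m + 1)) :
      siteSigma 2 j * siteSigma 1 (j + 1) * reflection (m + 1) =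
        reflection (m + 1) * (siteSigma 1 (j + 1).rev * siteSigma 2 j.rev) := by
    rw [mul_assoc, siteSigma_mul_reflection, ← mul_assoc, siteSigma_mul_reflection, mul_assoc,
      siteSigma_comm (by simpa using hne j)]
  have h3 (j : Fin (m + 1)) : siteSigma 3 j * (quarterTurns m * reflection (m + 1)) =
      quarterTurns m * reflection (m + 1) * siteSigma 3 j.rev := by
    rw [← mul_assoc, siteSigma_three_mul_quarterTurns, mul_assoc, siteSigma_mul_reflection,
      mul_assoc]
  have h12 (j : Fin (m + 1)) : (ε : ℂ) • (siteSigma 1 j * siteSigma 2 (j + 1)) *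
      (quarterTurns m * reflection (m + 1)) = quarterTurns m * reflection (m + 1) *
        ((ε * if (j + 1).rev = Fin.last m then -1 else 1 : ℂ) •
          (siteSigma 1 (j + 1).rev * siteSigma 2 ((j + 1).rev + 1))) := by
    rw [smul_mul_assoc, ← mul_assoc, hbond, smul_mul_assoc, mul_assoc, hrefl, smul_smul, hrev,
      mul_smul_comm, mul_assoc]
    simp only [hlast]
  rw [hamXYplusZ, twistedHam, Finset.sum_add_distrib, Finset.sum_add_distrib, add_mul, mul_add,
    Finset.sum_mul, Finset.sum_mul, Finset.mul_sum, Finset.mul_sum]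
  simp only [h3, h12]
  congr 1
  · exact Fintype.sum_equiv ((Equiv.addRight 1).trans Fin.revPerm) _ _ fun j => rfl
  · exact Fintype.sum_equiv Fin.revPerm _ _ fun j => rfl

open Matrix in
/-- Every eigenvalue of the Hamiltonian that is cyclic in the Majorana operators is, up to sign, an
eigenvalue of the spin Hamiltonian. -/
theorem exists_eigenvector_hamXYplusZ (hm : m ≠ 0) (hm2 : Even m) (ε : ℝ) (E : ℂ)
    (v : (Fin (m + 1) → Fin 2) → ℂ) (hv : v ≠ 0) (h : majoranaHam m ε *ᵥ v = E • v) :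
    ∃ w ≠ 0, hamXYplusZ (m + 1) ε *ᵥ w = (-E) • w := by
  have hcomm : majoranaHam m ε *ᵥ (parity (m + 1) *ᵥ v) = E • parity (m + 1) *ᵥ v := by
    rw [mulVec_mulVec, ← (commute_parity_majoranaHam ε).eq, ← mulVec_mulVec, h, mulVec_smul]
  have hPP : parity (m + 1) *ᵥ (parity (m + 1) *ᵥ v) = v := by
    rw [mulVec_mulVec, parity_mul_parity, one_mulVec]
  -- Either `v` has even parity, or its odd component is a nonzero eigenvector with the same
  -- eigenvalue, since parity commutes with the Majorana Hamiltonian.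
  by_cases hs : v - parity (m + 1) *ᵥ v = 0
  · have hP : parity (m + 1) *ᵥ v = (1 : ℂ) • v := by rw [one_smul]; exact (sub_eq_zero.1 hs).symm
    have hH := majoranaHam_mulVec hm ε 1 v hP
    obtain ⟨T, hT⟩ := exists_quarterTurns_left_inv (m := m)
    refine ⟨(quarterTurns m * reflection (m + 1)) *ᵥ v, fun h0 => hv ?_, ?_⟩
    · have := congrArg ((reflection (m + 1) * T) *ᵥ ·) h0
      simp only [mulVec_mulVec, mulVec_zero] at this
      rwa [mul_assoc, ← mul_assoc T, hT, one_mul, reflection_mul_reflection, one_mulVec] at this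
    · rw [mulVec_mulVec, hamXYplusZ_mul_quarterTurns_mul_reflection hm hm2, ← mulVec_mulVec,
        ← mulVec_smul]
      congr 1
      rw [neg_smul, ← h, hH, neg_neg]
  · refine ⟨_, hs, ?_⟩
    have hP : parity (m + 1) *ᵥ (v - parity (m + 1) *ᵥ v) =
        (-1 : ℂ) • (v - parity (m + 1) *ᵥ v) := by
      rw [mulVec_sub, hPP, neg_one_smul, neg_sub]
    have hH := majoranaHam_mulVec hm ε (-1) _ hP
    rw [neg_neg, twistedHam_one] at hH
    rw [neg_smul, ← neg_eq_iff_eq_neg, ← hH, mulVec_sub, h, hcomm, smul_sub]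

end Chain

open Matrix in
/-- The spectrum of the chain consists of all signed sums of the mode energies. -/
theorem exists_eigenvector_signed_sum {m : ℕ} (hm : m ≠ 0) (hm2 : Even m) (ε : ℝ)
    (x : ZMod (m + 1) → ℤˣ) :
    ∃ w ≠ 0, hamXYplusZ (m + 1) ε *ᵥ w =
      ((∑ k, ((x k : ℤ) : ℝ) * modeEnergy ε k : ℝ) : ℂ) • w := by
  have h1 : (1 : ZMod (m + 1)) ≠ 0 := by
    intro h
    exact hm (by simpa using (show (1 : Fin (m + 1)) = 0 from h))
  have hanti (i j : Fin (m + 1) ⊕ Fin (m + 1)) :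
      Matrix.toLinAlgEquiv' (majorana i) * Matrix.toLinAlgEquiv' (majorana j) +
        Matrix.toLinAlgEquiv' (majorana j) * Matrix.toLinAlgEquiv' (majorana i) =
      if i = j then 2 else 0 := by
    rw [← map_mul, ← map_mul, ← map_add, majorana_anticomm]
    split_ifs
    · exact map_ofNat Matrix.toLinAlgEquiv' 2
    · exact map_zero Matrix.toLinAlgEquiv'
  -- The pattern `-x` compensates for the change of sign between the Majorana and spin Hamiltonians.
  obtain ⟨v, hv, h⟩ := exists_eigenvector_of_majorana (n := m + 1)
    (V := (Fin (m + 1) → Fin 2) → ℂ) h1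
    (fun i => Matrix.toLinAlgEquiv' (majorana (n := m + 1) i)) hanti ε (-x)
  obtain ⟨w, hw, hH⟩ := exists_eigenvector_hamXYplusZ hm hm2 ε _ v hv (by
    rw [← h, ← Matrix.toLinAlgEquiv'_apply]
    refine LinearMap.congr_fun ?_ v
    simp only [majoranaHam, map_sum, map_add, map_smul, map_mul]
    rfl)
  refine ⟨w, hw, ?_⟩
  rw [hH]
  congr 1
  simp

/-- A matrix with as many distinct eigenvalues as its size has simple spectrum. -/
theorem hasNondegenerateSpectrum_of_injective {ι κ : Type*} [Fintype ι] [DecidableEq ι]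
    [Fintype κ] (A : Matrix ι ι ℂ) (E : κ → ℂ) (hE : Function.Injective E)
    (hcard : Fintype.card κ = Fintype.card ι)
    (h : ∀ k, ∃ w ≠ 0, A.mulVec w = E k • w) : HasNondegenerateSpectrum A := by
  classical
  have hroot (k : κ) : E k ∈ A.charpoly.roots.toFinset := by
    obtain ⟨w, hw, hA⟩ := h k
    rw [Multiset.mem_toFinset, Polynomial.mem_roots A.charpoly_monic.ne_zero, Polynomial.IsRoot,
      Matrix.eval_charpoly]
    refine Matrix.exists_mulVec_eq_zero_iff.1 ⟨w, hw, ?_⟩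
    rw [Matrix.sub_mulVec, hA, Matrix.scalar_apply, ← Matrix.smul_one_eq_diagonal,
      Matrix.smul_mulVec, Matrix.one_mulVec, sub_self]
  have hle : Fintype.card ι ≤ A.charpoly.roots.toFinset.card := by
    rw [← hcard, ← Finset.card_univ, ← Finset.card_image_of_injective _ hE]
    exact Finset.card_le_card (Finset.image_subset_iff.2 fun k _ => hroot k)
  have hdeg := A.charpoly.card_roots'
  rw [Matrix.charpoly_natDegree_eq_dim] at hdeg
  rw [HasNondegenerateSpectrum, ← Multiset.toFinset_card_eq_card_iff_nodup]
  exact le_antisymm (Multiset.toFinset_card_le _) (hdeg.trans hle)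

theorem mainTheorem5 (n : ℕ) [NeZero n] (hn : n.Prime) (hodd : Odd n) :
    ∃ ε : ℝ, HasNondegenerateSpectrum (hamXYplusZ n ε) := by
  obtain ⟨ε, hε⟩ := exists_sum_modeEnergy_injective hn hodd
  obtain ⟨m, rfl⟩ : ∃ m, n = m + 1 := ⟨n - 1, by have := hn.pos; omega⟩
  have hm : m ≠ 0 := by rintro rfl; exact hn.one_lt.ne rfl
  have hm2 : Even m := by
    rcases Nat.even_or_odd m with h | h
    · exact h
    · exact absurd hodd (by simpa using h.add_one)
  refine ⟨ε, hasNondegenerateSpectrum_of_injective _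
    (fun x : ZMod (m + 1) → ℤˣ => ((∑ k, ((x k : ℤ) : ℝ) * modeEnergy ε k : ℝ) : ℂ))
    (Complex.ofReal_injective.comp hε) ?_ (exists_eigenvector_signed_sum hm hm2 ε)⟩
  simp [ZMod.card]
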